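/- Let $\overrightarrow{G}=([n],E)$ be a digraph without loops and with at most one edge from $u$ to $v$ for each ordered pair $(u,v)$ (edges $(u,v)$ and $(v,u)$ may both be present), and let $G$ be its underlying undirected simple graph. Let $$X_{\overrightarrow{G}}(\mathbf{x},t)=\sum_{\kappa}t^{\mathrm{asc}(\kappa)}\,x_{\kappa(1)}\cdots x_{\kappa(n)},$$ where $\kappa:[n]\to\{1,2,\dots\}$ runs over the proper colorings of $G$ and $\mathrm{asc}(\kappa)$ is the number of directed edges $(u,v)\in E$ with $\kappa(u)<\kappa(v)$. For $S\subseteq[n-1]$ let $$F_{n,S}(\mathbf{x})=\sum x_{i_1}x_{i_2}\cdots x_{i_n},$$ over all $i_1\ge i_2\ge\cdots\ge i_n\ge 1$ with $i_j>i_{j+1}$ for all $j\in S$, be Gessel's fundamental quasisymmetric function; the $F_{n,S}$ with $n\ge 0$ and $S\subseteq[n-1]$ form a basis of the $\mathbb{Q}[t]$-module $\mathrm{QSym}_{\mathbb{Q}}[t]=\mathrm{QSym}_{\mathbb{Q}[t]}$ of quasisymmetric functions, and $X_{\overrightarrow{G}}$ lies in this module. Let $\omega$ be the $\mathbb{Q}[t]$-linear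 involution of this module with $\omega F_{n,S}=F_{n,[n-1]\setminus S}$. For $\sigma=\sigma_1\cdots\sigma_n\in\mathfrak{S}_n$ let $\mathrm{inv}_{\overrightarrow{G}}(\sigma)$ be the number of $\overrightarrow{G}$-inversions of $\sigma$, that is, of directed edges $(u,v)\in E$ such that $v$ precedes $u$ in $\sigma$. The $(G,\sigma)$-rank $\mathrm{rank}_{(G,\sigma)}(x)$ of $x\in[n]$ is the length $k$ of the longest subword $\sigma_{i_1}\cdots\sigma_{i_k}$ of $\sigma$, $i_1<\cdots<i_k$, with $\sigma_{i_k}=x$ and $\{\sigma_{i_j},\sigma_{i_{j+1}}\}$ an edge of $G$ for all $1\le j<k$. Let $\mathrm{DES}_G(\sigma)$ be the set of $G$-descents of $\sigma$, that is, of all $i$ with $1\le i<n$ such that either $\mathrm{rank}_{(G,\sigma)}(\sigma_i)>\mathrm{rank}_{(G,\sigma)}(\sigma_{i+1})$, or $\mathrm{rank}_{(G,\sigma)}(\sigma_i)=\mathrm{rank}_{(G,\sigma)}(\sigma_{i+1})$ and $\sigma_i>\sigma_{i+1}$. Then $$\omega X_{\overrightarrow{G}}(\mathbf{x},t)=\sum_{\sigma\in\mathfrak{S}_n}F_{n,\mathrm{DES}_G(\sigma)}(\mathbf{x})\,t^{\mathrm{inv}_{\overrightarrow{G}}(\sigma)}.$$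 In particular, $\omega X_{\overrightarrow{G}}(\mathbf{x},t)$ is $F$-positive: its coefficients in the basis $(F_{m,S})$ are polynomials in $t$ with nonnegative coefficients. -/

import Mathlib

namespace ChromaticQSym

/-! ### Formal power series in `x₁, x₂, …`: generating series of words and colourings -/

/-- The exponent vector of the monomial `x_κ = ∏_v x_{κ(v)}`. -/
noncomputable def xMon {V : Type*} [Fintype V] (κ : V → ℕ+) : ℕ+ →₀ ℕ :=
  ∑ v, Finsupp.single (κ v) 1

open Classical in
/-- The finite set of all maps `κ : V → {1, 2, …}` with `x_κ = x^m`. -/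
noncomputable def withMon {V : Type*} [Fintype V] (m : ℕ+ →₀ ℕ) : Finset (V → ℕ+) :=
  (Fintype.piFinset fun _ => m.support).filter fun κ => xMon κ = m

/-- The formal power series `∑_κ wt(κ) x_κ`, over all maps `κ : V → {1, 2, …}`. -/
noncomputable def genSeries {R : Type*} [CommRing R] {V : Type*} [Fintype V]
    (wt : (V → ℕ+) → R) : MvPowerSeries ℕ+ R :=
  fun m => ∑ κ ∈ withMon m, wt κ

theorem mem_withMon {V : Type*} [Fintype V] (m : ℕ+ →₀ ℕ) (κ : V → ℕ+) :
    κ ∈ withMon m ↔ xMon κ = m := by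
  classical
  simp only [withMon, Finset.mem_filter, Fintype.mem_piFinset, and_iff_right_iff_imp]
  rintro rfl v
  rw [Finsupp.mem_support_iff, xMon, Finsupp.finsetSum_apply]
  intro h
  have := (Finset.sum_eq_zero_iff.mp h) v (Finset.mem_univ v)
  simp at this

theorem coeff_genSeries {R : Type*} [CommRing R] {V : Type*} [Fintype V]
    (wt : (V → ℕ+) → R) (m : ℕ+ →₀ ℕ) :
    MvPowerSeries.coeff m (genSeries wt) = ∑ κ ∈ withMon m, wt κ := rfl

theorem degree_xMon {V : Type*} [Fintype V] (κ : V → ℕ+) :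
    (xMon κ).degree = Fintype.card V := by
  simp [xMon]

theorem mem_support_xMon {V : Type*} [Fintype V] (κ : V → ℕ+) (v : V) :
    κ v ∈ (xMon κ).support := by
  classical
  have h := (mem_withMon (xMon κ) κ).2 rfl
  simp only [withMon, Finset.mem_filter, Fintype.mem_piFinset] at h
  exact h.1 v

theorem xMon_comp {V : Type*} [Fintype V] (φ : ℕ+ → ℕ+) (κ : V → ℕ+) :
    xMon (φ ∘ κ) = Finsupp.mapDomain φ (xMon κ) := by
  simp [xMon, Finsupp.mapDomain_finsetSum, Finsupp.mapDomain_single]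

/-! ### Quasisymmetric functions -/

/-- For all `i₁ < ⋯ < i_k` and `j₁ < ⋯ < j_k`, the monomials `x_{i₁}^{a₁} ⋯ x_{i_k}^{a_k}` and
`x_{j₁}^{a₁} ⋯ x_{j_k}^{a_k}` have the same coefficient. -/
def IsQuasisymmetric {R : Type*} [CommRing R] (f : MvPowerSeries ℕ+ R) : Prop :=
  ∀ (k : ℕ) (a : Fin k → ℕ) (i j : Fin k → ℕ+), StrictMono i → StrictMono j →
    MvPowerSeries.coeff (∑ l, Finsupp.single (i l) (a l)) f =
      MvPowerSeries.coeff (∑ l, Finsupp.single (j l) (a l)) f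

/-- The `R`-module of quasisymmetric functions in `x₁, x₂, …`: the power series of bounded degree
that are quasisymmetric. -/
def QSym (R : Type*) [CommRing R] : Submodule R (MvPowerSeries ℕ+ R) where
  carrier := {f | (∃ d : ℕ, ∀ m : ℕ+ →₀ ℕ, d < m.degree → MvPowerSeries.coeff m f = 0) ∧
    IsQuasisymmetric f}
  zero_mem' := ⟨⟨0, fun _ _ => rfl⟩, fun _ _ _ _ _ _ => rfl⟩
  add_mem' := by
    rintro f g ⟨⟨d, hd⟩, hf⟩ ⟨⟨e, he⟩, hg⟩
    refine ⟨⟨max d e, fun m hm => ?_⟩, fun k a i j hi hj => ?_⟩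
    · rw [map_add, hd m (lt_of_le_of_lt (le_max_left _ _) hm),
        he m (lt_of_le_of_lt (le_max_right _ _) hm), add_zero]
    · rw [map_add, map_add, hf k a i j hi hj, hg k a i j hi hj]
  smul_mem' := by
    rintro c f ⟨⟨d, hd⟩, hf⟩
    refine ⟨⟨d, fun m hm => ?_⟩, fun k a i j hi hj => ?_⟩
    · rw [map_smul, hd m hm, smul_zero]
    · rw [map_smul, map_smul, hf k a i j hi hj]

/-- A generating series whose weight only depends on the relative order of the values is
quasisymmetric. -/
theorem genSeries_mem {R : Type*} [CommRing R] {V : Type*} [Fintype V] (wt : (V → ℕ+) → R)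
    (hwt : ∀ κ κ' : V → ℕ+, (∀ u v, κ u < κ v ↔ κ' u < κ' v) → wt κ = wt κ') :
    genSeries wt ∈ QSym R := by
  classical
  refine ⟨⟨Fintype.card V, fun m hm => ?_⟩, fun k a i j hi hj => ?_⟩
  · rw [coeff_genSeries]
    refine Finset.sum_eq_zero fun κ hκ => ?_
    rw [mem_withMon] at hκ
    rw [← hκ, degree_xMon] at hm
    exact absurd hm (lt_irrefl _)
  · have hmap : ∀ i j : Fin k → ℕ+, StrictMono i →
        Finsupp.mapDomain (Function.extend i j id) (∑ l, Finsupp.single (i l) (a l)) =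
          ∑ l, Finsupp.single (j l) (a l) := by
      intro i j hi
      rw [Finsupp.mapDomain_finsetSum]
      refine Finset.sum_congr rfl fun l _ => ?_
      rw [Finsupp.mapDomain_single, hi.injective.extend_apply]
    have hrange : ∀ (i : Fin k → ℕ+) (κ : V → ℕ+),
        κ ∈ withMon (∑ l, Finsupp.single (i l) (a l)) → ∀ v, ∃ l, i l = κ v := by
      intro i κ hκ v
      rw [mem_withMon] at hκ
      have h := mem_support_xMon κ v
      rw [hκ, Finsupp.mem_support_iff, Finsupp.finsetSum_apply] at h
      obtain ⟨l, _, hl⟩ := Finset.exists_ne_zero_of_sum_ne_zero h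
      exact ⟨l, by by_contra hne; exact hl (Finsupp.single_eq_of_ne (Ne.symm hne))⟩
    have hmem : ∀ i j : Fin k → ℕ+, StrictMono i → ∀ κ : V → ℕ+,
        κ ∈ withMon (∑ l, Finsupp.single (i l) (a l)) →
        Function.extend i j id ∘ κ ∈ withMon (∑ l, Finsupp.single (j l) (a l)) := by
      intro i j hi κ hκ
      rw [mem_withMon] at hκ ⊢
      rw [xMon_comp, hκ, hmap i j hi]
    have hinv : ∀ i j : Fin k → ℕ+, StrictMono i → StrictMono j → ∀ κ : V → ℕ+,
        κ ∈ withMon (∑ l, Finsupp.single (i l) (a l)) →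
        Function.extend j i id ∘ (Function.extend i j id ∘ κ) = κ := by
      intro i j hi hj κ hκ
      funext v
      obtain ⟨l, hl⟩ := hrange i κ hκ v
      simp only [Function.comp_apply, ← hl, hi.injective.extend_apply,
        hj.injective.extend_apply]
    rw [coeff_genSeries, coeff_genSeries]
    refine Finset.sum_nbij' (fun κ => Function.extend i j id ∘ κ)
      (fun κ => Function.extend j i id ∘ κ) (hmem i j hi) (hmem j i hj)
      (hinv i j hi hj) (hinv j i hj hi) fun κ hκ => hwt _ _ fun u v => ?_
    obtain ⟨l, hl⟩ := hrange i κ hκ u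
    obtain ⟨l', hl'⟩ := hrange i κ hκ v
    simp only [Function.comp_apply, ← hl, ← hl', hi.injective.extend_apply, hi.lt_iff_lt,
      hj.lt_iff_lt]

/-! ### Gessel's fundamental quasisymmetric functions

A subset of `[n-1]` is a `Finset (Fin (n - 1))`; the element `i` of `Fin (n - 1)` stands for
`i + 1 ∈ [n-1]`, and `[n]` is `Fin n` in the same way. -/

/-- The `i`-th of the positions `1, …, n-1` of a word of length `n`. -/
def here {n : ℕ} (i : Fin (n - 1)) : Fin n := ⟨i, by omega⟩

/-- The position that follows `here i`. -/
def next {n : ℕ} (i : Fin (n - 1)) : Fin n := ⟨i + 1, by omega⟩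

/-- The words `w₁ ≥ w₂ ≥ ⋯ ≥ w_n` with `w_i > w_{i+1}` for all `i ∈ S`. -/
def IsFWord (n : ℕ) (S : Finset (Fin (n - 1))) (w : Fin n → ℕ+) : Prop :=
  Antitone w ∧ ∀ i ∈ S, w (next i) < w (here i)

open Classical in
/-- Gessel's `F_{n,S} = ∑ x_{w₁} ⋯ x_{w_n}`, over all `w₁ ≥ w₂ ≥ ⋯ ≥ w_n ≥ 1` with
`w_i > w_{i+1}` for all `i ∈ S`. -/
noncomputable def fundamental (R : Type*) [CommRing R] (n : ℕ) (S : Finset (Fin (n - 1))) :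
    QSym R :=
  ⟨genSeries fun w : Fin n → ℕ+ => if IsFWord n S w then 1 else 0, genSeries_mem _ (by
    intro κ κ' h
    have h' : ∀ u v, κ u ≤ κ v ↔ κ' u ≤ κ' v := fun u v => by
      rw [← not_lt, ← not_lt, h]
    have hiff : IsFWord n S κ ↔ IsFWord n S κ' := by simp only [IsFWord, Antitone, h, h']
    simp only [hiff])⟩

/-! ### The fundamental quasisymmetric functions form a basis -/

/-- The smallest decreasing word with strict descents exactly at `S`. -/
def canon (n : ℕ) (S : Finset (Fin (n - 1))) (j : Fin n) : ℕ+ :=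
  ⟨(S.filter fun i : Fin (n - 1) => (j : ℕ) ≤ i).card + 1, Nat.succ_pos _⟩

theorem canon_antitone (n : ℕ) (S : Finset (Fin (n - 1))) : Antitone (canon n S) := by
  intro j k hjk
  rw [← PNat.coe_le_coe]
  simp only [canon, PNat.mk_coe, add_le_add_iff_right]
  refine Finset.card_le_card fun i hi => ?_
  rw [Finset.mem_filter] at hi ⊢
  exact ⟨hi.1, le_trans (by exact_mod_cast hjk) hi.2⟩

theorem canon_lt_iff (n : ℕ) (S : Finset (Fin (n - 1))) (i : Fin (n - 1)) :
    canon n S (next i) < canon n S (here i) ↔ i ∈ S := by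
  rw [← PNat.coe_lt_coe]
  have h1 : ((here i : Fin n) : ℕ) = i := rfl
  have h2 : ((next i : Fin n) : ℕ) = i + 1 := rfl
  simp only [canon, PNat.mk_coe, add_lt_add_iff_right]
  constructor
  · intro h
    by_contra hi
    refine absurd h (not_lt.2 (Finset.card_le_card fun j hj => ?_))
    rw [Finset.mem_filter] at hj ⊢
    refine ⟨hj.1, ?_⟩
    have hne : (i : ℕ) ≠ j := fun he => hi (Fin.ext he ▸ hj.1)
    omega
  · intro hi
    refine Finset.card_lt_card ((Finset.ssubset_iff_of_subset ?_).2 ⟨i, ?_, ?_⟩)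
    · intro j hj
      rw [Finset.mem_filter] at hj ⊢
      exact ⟨hj.1, by omega⟩
    · simpa [h1] using hi
    · simp [h2]

theorem isFWord_canon_iff (n : ℕ) (S T : Finset (Fin (n - 1))) :
    IsFWord n S (canon n T) ↔ S ⊆ T := by
  simp only [IsFWord, canon_antitone, true_and, canon_lt_iff]
  rfl

theorem xMon_eq_toFinsupp {n : ℕ} (w : Fin n → ℕ+) :
    xMon w = Multiset.toFinsupp (List.ofFn w : Multiset ℕ+) := by
  ext a
  rw [Multiset.toFinsupp_apply, Multiset.coe_count, xMon, Finsupp.finsetSum_apply]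
  induction n with
  | zero => simp
  | succ n ih =>
    rw [Fin.sum_univ_succ, List.ofFn_succ, List.count_cons, ih, add_comm]
    simp [Finsupp.single_apply]

theorem antitone_ext {n : ℕ} {w w' : Fin n → ℕ+} (hw : Antitone w) (hw' : Antitone w')
    (h : xMon w = xMon w') : w = w' := by
  rw [xMon_eq_toFinsupp, xMon_eq_toFinsupp] at h
  have hp : (List.ofFn w).Perm (List.ofFn w') :=
    Multiset.coe_eq_coe.1 (Multiset.toFinsupp.injective h)
  exact List.ofFn_injective (hp.eq_of_sortedGE hw.sortedGE_ofFn hw'.sortedGE_ofFn)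

theorem exists_antitone (m : ℕ+ →₀ ℕ) :
    ∃ (n : ℕ) (w : Fin n → ℕ+), Antitone w ∧ xMon w = m := by
  refine ⟨_, ((Finsupp.toMultiset m).sort (· ≥ ·)).get, ?_, ?_⟩
  · rw [← List.sortedGE_ofFn_iff, List.ofFn_get]
    exact ((Finsupp.toMultiset m).pairwise_sort (· ≥ ·)).sortedGE
  · rw [xMon_eq_toFinsupp, List.ofFn_get, Multiset.sort_eq, Finsupp.toMultiset_toFinsupp]

theorem antitone_lt_iff {n : ℕ} {w : Fin n → ℕ+} (hw : Antitone w) (u v : Fin n) :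
    w u < w v ↔ ∃ i : Fin (n - 1), v ≤ here i ∧ next i ≤ u ∧ w (next i) < w (here i) := by
  constructor
  · intro h
    by_contra! hc
    have key : ∀ (k : ℕ) (hk : v.1 + k < n), v.1 + k ≤ u.1 → w v ≤ w ⟨v.1 + k, hk⟩ := by
      intro k
      induction k with
      | zero => intro _ _; exact le_refl _
      | succ k ih =>
        intro hk hu
        refine (ih (by omega) (by omega)).trans ?_
        exact hc ⟨v.1 + k, by omega⟩ (by simp [here, Fin.le_def])
          (by simp only [next, Fin.le_def]; omega)
    have hvu : v.1 ≤ u.1 := by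
      by_contra hlt
      exact absurd (hw (show u ≤ v from by rw [Fin.le_def]; omega)) (not_le.2 h)
    have h1 := key (u.1 - v.1) (by omega) (by omega)
    have h2 : (⟨v.1 + (u.1 - v.1), by omega⟩ : Fin n) = u := Fin.ext (by simp; omega)
    rw [h2] at h1
    exact absurd h (not_lt.2 h1)
  · rintro ⟨i, h1, h2, h3⟩
    exact (hw h2).trans_lt (h3.trans_le (hw h1))

theorem coeff_eq_of_desc {R : Type*} [CommRing R] {f : MvPowerSeries ℕ+ R}
    (hf : IsQuasisymmetric f) {n : ℕ} {w w' : Fin n → ℕ+} (hw : Antitone w) (hw' : Antitone w')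
    (h : ∀ i, w (next i) < w (here i) ↔ w' (next i) < w' (here i)) :
    MvPowerSeries.coeff (xMon w) f = MvPowerSeries.coeff (xMon w') f := by
  classical
  have hlt : ∀ u v, w u < w v ↔ w' u < w' v := fun u v => by
    rw [antitone_lt_iff hw, antitone_lt_iff hw']
    simp only [h]
  have heq : ∀ u v, w u = w v → w' u = w' v := fun u v he =>
    le_antisymm (not_lt.1 fun hc => by rw [← hlt, he] at hc; exact lt_irrefl _ hc)
      (not_lt.1 fun hc => by rw [← hlt, he] at hc; exact lt_irrefl _ hc)
  set s := (xMon w).support with hs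
  let i : Fin s.card → ℕ+ := s.orderEmbOfFin rfl
  have hi : StrictMono i := (s.orderEmbOfFin rfl).strictMono
  have hir : ∀ l, ∃ v, w v = i l := by
    intro l
    have h1 : i l ∈ s := s.orderEmbOfFin_mem rfl l
    rw [hs, Finsupp.mem_support_iff, xMon, Finsupp.finsetSum_apply] at h1
    obtain ⟨v, _, hv⟩ := Finset.exists_ne_zero_of_sum_ne_zero h1
    exact ⟨v, by by_contra hne; exact hv (Finsupp.single_eq_of_ne (Ne.symm hne))⟩
  choose p hp using hir
  have hj : StrictMono fun l => w' (p l) := by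
    intro a b hab
    have h1 := hi hab
    rw [← hp a, ← hp b, hlt] at h1
    exact h1
  have e1 : xMon w = ∑ l, Finsupp.single (i l) (xMon w (i l)) := by
    conv_lhs => rw [← Finsupp.sum_single (xMon w), Finsupp.sum, ← hs,
      ← Finset.image_orderEmbOfFin_univ s rfl, Finset.sum_image fun _ _ _ _ h => hi.injective h]
  have e2 : xMon w' = ∑ l, Finsupp.single (w' (p l)) (xMon w (i l)) := by
    have hφ : w' = Function.extend i (fun l => w' (p l)) id ∘ w := by
      funext v
      have hv : w v ∈ Set.range i := by
        have h1 : w v ∈ s := mem_support_xMon w v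
        rwa [← Finset.mem_coe, ← Finset.range_orderEmbOfFin s rfl] at h1
      obtain ⟨l, hl⟩ := hv
      rw [Function.comp_apply, ← hl, hi.injective.extend_apply]
      exact heq _ _ (by rw [hp, hl])
    conv_lhs => rw [hφ, xMon_comp, e1, Finsupp.mapDomain_finsetSum]
    refine Finset.sum_congr rfl fun l _ => ?_
    rw [Finsupp.mapDomain_single, hi.injective.extend_apply]
  rw [e1, e2]
  exact hf _ _ _ _ hi hj

theorem QSym_ext {R : Type*} [CommRing R] {f g : QSym R}
    (h : ∀ n S, MvPowerSeries.coeff (xMon (canon n S)) f.1 =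
      MvPowerSeries.coeff (xMon (canon n S)) g.1) : f = g := by
  classical
  refine Subtype.ext (MvPowerSeries.ext fun m => ?_)
  obtain ⟨n, w, hw, rfl⟩ := exists_antitone m
  have hd : ∀ i, w (next i) < w (here i) ↔
      canon n (Finset.univ.filter fun i => w (next i) < w (here i)) (next i) <
        canon n (Finset.univ.filter fun i => w (next i) < w (here i)) (here i) := by
    intro i
    rw [canon_lt_iff]
    simp
  rw [coeff_eq_of_desc f.2.2 hw (canon_antitone _ _) hd,
    coeff_eq_of_desc g.2.2 hw (canon_antitone _ _) hd, h]

theorem coeff_fundamental_of_ne {R : Type*} [CommRing R] {n : ℕ} (S : Finset (Fin (n - 1)))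
    {m : ℕ+ →₀ ℕ} (hm : m.degree ≠ n) :
    MvPowerSeries.coeff m (fundamental R n S).1 = 0 := by
  classical
  refine Finset.sum_eq_zero fun κ hκ => absurd ?_ hm
  rw [mem_withMon] at hκ
  rw [← hκ, degree_xMon, Fintype.card_fin]

open Classical in
theorem coeff_fundamental_canon (R : Type*) [CommRing R] (n : ℕ) (S T : Finset (Fin (n - 1))) :
    MvPowerSeries.coeff (xMon (canon n T)) (fundamental R n S).1 = if S ⊆ T then 1 else 0 := by
  refine (Finset.sum_eq_single (canon n T) ?_ ?_).trans ?_
  · intro κ hκ hne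
    rw [mem_withMon] at hκ
    exact if_neg fun hF => hne (antitone_ext hF.1 (canon_antitone _ _) hκ)
  · intro hc
    exact absurd ((mem_withMon _ _).2 rfl) hc
  · simp only [isFWord_canon_iff]

theorem linearIndependent_fundamental (R : Type*) [CommRing R] :
    LinearIndependent R fun p : Σ n : ℕ, Finset (Fin (n - 1)) => fundamental R p.1 p.2 := by
  classical
  rw [linearIndependent_iff]
  intro l hl
  have key : ∀ (k n : ℕ) (T : Finset (Fin (n - 1))), T.card = k → l ⟨n, T⟩ = 0 := by
    intro k
    induction k using Nat.strong_induction_on with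
    | _ k ih =>
      intro n T hT
      have h0 : MvPowerSeries.coeff (xMon (canon n T))
          ((QSym R).subtype (Finsupp.linearCombination R
            (fun p : Σ n : ℕ, Finset (Fin (n - 1)) => fundamental R p.1 p.2) l)) = 0 := by
        rw [hl, map_zero, map_zero]
      rw [Finsupp.linearCombination_apply, Finsupp.sum, map_sum, map_sum,
        Finset.sum_eq_single ⟨n, T⟩] at h0
      · simpa [coeff_fundamental_canon] using h0
      · rintro ⟨n', S⟩ _ hne
        rw [map_smul, map_smul, Submodule.subtype_apply]
        by_cases hn : n = n'
        · subst hn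
          rw [coeff_fundamental_canon]
          split_ifs with hST
          · have hss : S ⊂ T := lt_of_le_of_ne hST fun he => hne (by rw [he])
            rw [ih S.card (hT ▸ Finset.card_lt_card hss) n S rfl, zero_smul]
          · rw [smul_zero]
        · rw [coeff_fundamental_of_ne, smul_zero]
          rw [degree_xMon, Fintype.card_fin]
          exact hn
      · intro hn
        rw [Finsupp.notMem_support_iff.1 hn, zero_smul, map_zero, map_zero]
  ext ⟨n, T⟩
  exact key _ n T rfl

theorem exists_sum_powerset {R : Type*} [CommRing R] {α : Type*} [DecidableEq α]
    (c : Finset α → R) : ∃ a : Finset α → R, ∀ T, ∑ S ∈ T.powerset, a S = c T := by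
  refine ⟨Finset.strongInduction fun T ih =>
    c T - ∑ S ∈ T.ssubsets.attach, ih S.1 (Finset.mem_ssubsets.1 S.2), fun T => ?_⟩
  rw [← Finset.insert_erase (Finset.mem_powerset_self T),
    Finset.sum_insert (Finset.notMem_erase _ _), Finset.strongInduction_eq,
    Finset.sum_attach T.ssubsets fun S => Finset.strongInduction _ S]
  exact sub_add_cancel _ _

theorem span_fundamental (R : Type*) [CommRing R] :
    ⊤ ≤ Submodule.span R (Set.range
      fun p : Σ n : ℕ, Finset (Fin (n - 1)) => fundamental R p.1 p.2) := by
  classical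
  rintro f -
  obtain ⟨d, hd⟩ := f.2.1
  choose a ha using fun n : ℕ => exists_sum_powerset
    fun T : Finset (Fin (n - 1)) => MvPowerSeries.coeff (xMon (canon n T)) f.1
  have hf : f = ∑ n ∈ Finset.range (d + 1), ∑ S : Finset (Fin (n - 1)),
      a n S • fundamental R n S := by
    refine QSym_ext fun n T => ?_
    change _ = MvPowerSeries.coeff (xMon (canon n T)) ((QSym R).subtype _)
    simp only [map_sum, map_smul, Submodule.subtype_apply]
    have hn : ∀ n' ∈ Finset.range (d + 1), n' ≠ n → ∑ S : Finset (Fin (n' - 1)),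
        a n' S • MvPowerSeries.coeff (xMon (canon n T)) (fundamental R n' S).1 = 0 := by
      intro n' _ hne
      refine Finset.sum_eq_zero fun S _ => ?_
      rw [coeff_fundamental_of_ne, smul_zero]
      rw [degree_xMon, Fintype.card_fin]
      exact hne.symm
    by_cases hnd : n ∈ Finset.range (d + 1)
    · rw [Finset.sum_eq_single_of_mem n hnd hn, ← ha n T]
      simp only [coeff_fundamental_canon, smul_eq_mul, mul_ite, mul_one, mul_zero]
      rw [← Finset.sum_filter]
      exact Finset.sum_congr (by ext; simp) fun _ _ => rfl
    · rw [hd, Finset.sum_eq_zero fun n' h' => hn n' h' fun he => hnd (he ▸ h')]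
      rw [degree_xMon, Fintype.card_fin]
      simpa using hnd
  rw [hf]
  exact Submodule.sum_mem _ fun n _ => Submodule.sum_mem _ fun S _ =>
    Submodule.smul_mem _ _ (Submodule.subset_span ⟨⟨n, S⟩, rfl⟩)

/-- The basis `(F_{n,S})`, `n ≥ 0`, `S ⊆ [n-1]`, of the module of quasisymmetric functions. -/
noncomputable def fundamentalBasis (R : Type*) [CommRing R] :
    Module.Basis (Σ n : ℕ, Finset (Fin (n - 1))) R (QSym R) :=
  Module.Basis.mk (linearIndependent_fundamental R) (span_fundamental R)

theorem fundamentalBasis_apply (R : Type*) [CommRing R] (n : ℕ) (S : Finset (Fin (n - 1))) :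
    fundamentalBasis R ⟨n, S⟩ = fundamental R n S :=
  Module.Basis.mk_apply _ _ _

/-! ### The involution `ω` and `F`-positivity -/

/-- The involution `ω` of the quasisymmetric functions: the `R`-linear map with
`ω F_{n,S} = F_{n,[n-1]∖S}`. It extends the involution of the symmetric functions that sends
`h_n = F_{n,∅}` to `e_n = F_{n,[n-1]}`. -/
noncomputable def omega (R : Type*) [CommRing R] : QSym R →ₗ[R] QSym R :=
  (fundamentalBasis R).constr R fun p => fundamental R p.1 p.2ᶜ

theorem omega_fundamental (R : Type*) [CommRing R] (n : ℕ) (S : Finset (Fin (n - 1))) :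
    omega R (fundamental R n S) = fundamental R n Sᶜ := by
  rw [omega, ← fundamentalBasis_apply, Module.Basis.constr_basis]

open scoped Polynomial in
/-- All coefficients in the expansion in the basis `(F_{n,S})` are polynomials in `t` with
nonnegative coefficients. -/
def IsFPositive (f : QSym ℚ[X]) : Prop :=
  ∀ (p : Σ n : ℕ, Finset (Fin (n - 1))) (k : ℕ),
    0 ≤ ((fundamentalBasis ℚ[X]).repr f p).coeff k

/-! ### The chromatic quasisymmetric function of a digraph -/

open Classical in
/-- The number of ascents of `κ`: directed edges `(u, v)` with `κ(u) < κ(v)`. -/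
noncomputable def asc {V : Type*} [Fintype V] (D : Digraph V) (κ : V → ℕ+) : ℕ :=
  (Finset.univ.filter fun e : V × V => D.Adj e.1 e.2 ∧ κ e.1 < κ e.2).card

/-- Proper colourings of a digraph are those of its underlying undirected graph. -/
def IsProper {V : Type*} (D : Digraph V) (κ : V → ℕ+) : Prop :=
  ∀ u v, D.toSimpleGraphInclusive.Adj u v → κ u ≠ κ v

open scoped Polynomial in
open Classical in
/-- `X_D(x, t) = ∑_κ t^{asc(κ)} x_κ`, over all proper colourings `κ : V → {1, 2, …}` of `D`, as a
quasisymmetric function with coefficients in `ℚ[t]`. -/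
noncomputable def chromatic {V : Type*} [Fintype V] (D : Digraph V) : QSym ℚ[X] :=
  ⟨genSeries fun κ : V → ℕ+ => if IsProper D κ then Polynomial.X ^ asc D κ else 0,
    genSeries_mem _ (by
      intro κ κ' h
      have h' : ∀ u v, κ u = κ v ↔ κ' u = κ' v := fun u v => by
        rw [← not_iff_not, ← Ne, ← Ne, lt_or_lt_iff_ne.symm, lt_or_lt_iff_ne.symm, h, h]
      have hp : IsProper D κ ↔ IsProper D κ' := by simp only [IsProper, ne_eq, h']
      have ha : asc D κ = asc D κ' := by simp only [asc, h]
      simp only [hp, ha])⟩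

/-! ### Permutation statistics

A permutation `σ` of `[n]` is the word `σ₁ σ₂ ⋯ σ_n` with `σ_i = σ i`. -/

open Classical in
/-- The number of `D`-inversions of `σ`: directed edges `(u, v)` with `σ⁻¹(u) > σ⁻¹(v)`. -/
noncomputable def inv {n : ℕ} (D : Digraph (Fin n)) (σ : Equiv.Perm (Fin n)) : ℕ :=
  (Finset.univ.filter fun e : Fin n × Fin n =>
    D.Adj e.1 e.2 ∧ σ.symm e.2 < σ.symm e.1).card

/-- The `(G, σ)`-rank of `x`: the largest length `k + 1` of a subword `σ_{i_0} ⋯ σ_{i_k}` of `σ`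
that ends in `x` and whose consecutive letters are adjacent in `G`. -/
noncomputable def rank {n : ℕ} (G : SimpleGraph (Fin n)) (σ : Equiv.Perm (Fin n))
    (x : Fin n) : ℕ :=
  sSup {L | ∃ (k : ℕ) (i : Fin (k + 1) → Fin n), L = k + 1 ∧ StrictMono i ∧
    σ (i (Fin.last k)) = x ∧ ∀ j : Fin k, G.Adj (σ (i j.castSucc)) (σ (i j.succ))}

open Classical in
/-- The set of `G`-descents of `σ`. -/
noncomputable def DES {n : ℕ} (G : SimpleGraph (Fin n)) (σ : Equiv.Perm (Fin n)) :
    Finset (Fin (n - 1)) :=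
  Finset.univ.filter fun i =>
    rank G σ (σ (next i)) < rank G σ (σ (here i)) ∨
      (rank G σ (σ (here i)) = rank G σ (σ (next i)) ∧ σ (next i) < σ (here i))

end ChromaticQSym

/-!
A proper colouring `κ` orients every edge of `G` towards its smaller colour. If the word
`σ₁ σ₂ ⋯ σ_n` lists the vertices in weakly decreasing order of colour, then this is the orientation
of the edges from left to right in `σ`. Hence `asc κ = inv σ`, and the `(G, σ)`-rank depends only
on `κ`. Therefore listing the vertices by decreasing colour, with ties broken by decreasing rank
and then by decreasing label, yields the unique `σ` for which `κ ∘ σ` is one of the words counted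
by `F_{n, [n-1] ∖ DES σ}`. Conversely, if `κ ∘ σ` is such a word then `κ` is proper: the rank
increases from left to right along every edge, whereas it weakly decreases along a run of equal
colours. Thus `X_D = ∑_σ t^{inv σ} F_{n, [n-1] ∖ DES σ}`, and `ω` takes complements.
-/

namespace ChromaticQSym

theorem lt_symm_iff_of_antitone_comp {α β γ : Type*} [LinearOrder α] [PartialOrder γ] {f : β → γ}
    {e : α ≃ β} (hf : Antitone (f ∘ e)) {x y : β} (hxy : f x = f y → x = y) :
    e.symm x < e.symm y ↔ f y < f x := by
  have hle : ∀ {u v : β}, e.symm u ≤ e.symm v → f v ≤ f u := fun h => by simpa using hf h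
  refine ⟨fun h => (hle h.le).lt_of_ne fun he => h.ne (by rw [hxy he.symm]), fun h => ?_⟩
  exact lt_of_not_ge fun hyx => (hle hyx).not_gt h

theorem exists_antitone_comp_perm {n : ℕ} {α : Type*} [LinearOrder α] (f : Fin n → α) :
    ∃ σ : Equiv.Perm (Fin n), Antitone (f ∘ σ) :=
  ⟨Tuple.sort (OrderDual.toDual ∘ f), Tuple.monotone_sort (OrderDual.toDual ∘ f)⟩

theorem existsUnique_strictAnti_comp_perm {n : ℕ} {α : Type*} [LinearOrder α] {f : Fin n → α}
    (hf : f.Injective) : ∃! σ : Equiv.Perm (Fin n), StrictAnti (f ∘ σ) := by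
  obtain ⟨σ, hσ⟩ := exists_antitone_comp_perm f
  refine ⟨σ, hσ.strictAnti_of_injective (hf.comp σ.injective), fun τ hτ => ?_⟩
  exact Equiv.ext fun x => hf (congrFun (Tuple.unique_antitone hτ.antitone hσ) x)

/-- The vertex `x` as an element of a linear order that compares first the colours `κ`, then the
ranks `r`, then the vertices themselves. -/
def sortKey {V α β : Type*} (κ : V → α) (r : V → β) (x : V) : α ×ₗ β ×ₗ V :=
  toLex (κ x, toLex (r x, x))

theorem sortKey_injective {V α β : Type*} (κ : V → α) (r : V → β) :
    (sortKey κ r).Injective :=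
  fun _ _ h => congrArg (fun p => (ofLex (ofLex p).2).2) h

section Words

variable {n : ℕ}

theorem antitone_iff_next_le_here {α : Type*} [Preorder α] {f : Fin n → α} :
    Antitone f ↔ ∀ i : Fin (n - 1), f (next i) ≤ f (here i) := by
  cases n with
  | zero => exact ⟨fun _ i => i.elim0, fun _ i => i.elim0⟩
  | succ n => exact Fin.antitone_iff_succ_le

theorem strictAnti_iff_next_lt_here {α : Type*} [Preorder α] {f : Fin n → α} :
    StrictAnti f ↔ ∀ i : Fin (n - 1), f (next i) < f (here i) := by
  cases n with
  | zero => exact ⟨fun _ i => i.elim0, fun _ i => i.elim0⟩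
  | succ n => exact Fin.strictAnti_iff_succ_lt

theorem isFWord_compl_iff {S : Finset (Fin (n - 1))} {w : Fin n → ℕ+} :
    IsFWord n Sᶜ w ↔
      ∀ i, w (next i) ≤ w (here i) ∧ (w (next i) = w (here i) → i ∈ S) := by
  rw [IsFWord, antitone_iff_next_le_here, ← forall_and]
  refine forall_congr' fun i => and_congr_right fun hle => ?_
  rw [Finset.mem_compl, hle.lt_iff_ne, not_imp_comm, not_not]

variable {G : SimpleGraph (Fin n)} {σ τ : Equiv.Perm (Fin n)} {κ : Fin n → ℕ+}

theorem mem_DES_iff_toLex_lt {i : Fin (n - 1)} :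
    i ∈ DES G σ ↔ toLex (rank G σ (σ (next i)), σ (next i)) <
      toLex (rank G σ (σ (here i)), σ (here i)) := by
  simp only [DES, Finset.mem_filter, Finset.mem_univ, true_and, Prod.Lex.toLex_lt_toLex,
    eq_comm (a := rank G σ (σ (here i)))]

theorem isFWord_compl_DES_iff :
    IsFWord n (DES G σ)ᶜ (κ ∘ σ) ↔ StrictAnti (sortKey κ (rank G σ) ∘ σ) := by
  simp only [isFWord_compl_iff, strictAnti_iff_next_lt_here, mem_DES_iff_toLex_lt,
    Function.comp_apply, sortKey, Prod.Lex.toLex_lt_toLex']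

/-- The acyclic orientation of `G` in which every edge points from left to right in the word
`σ₁ σ₂ ⋯ σ_n`, as the set of its arcs. -/
def orientation (G : SimpleGraph (Fin n)) (σ : Equiv.Perm (Fin n)) : SetRel (Fin n) (Fin n) :=
  {e | G.Adj e.1 e.2 ∧ σ.symm e.1 < σ.symm e.2}

theorem rank_eq_sSup_relSeries (G : SimpleGraph (Fin n)) (σ : Equiv.Perm (Fin n)) (x : Fin n) :
    rank G σ x = sSup {L | ∃ p : RelSeries (orientation G σ), L = p.length + 1 ∧ p.last = x} := by
  refine congrArg sSup (Set.ext fun L => ⟨?_, ?_⟩)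
  · rintro ⟨k, i, hL, hi, hx, hadj⟩
    exact ⟨⟨k, σ ∘ i, fun j => ⟨hadj j, by simpa using hi Fin.castSucc_lt_succ⟩⟩, hL, hx⟩
  · rintro ⟨p, hL, hx⟩
    exact ⟨p.length, σ.symm ∘ p, hL, Fin.strictMono_iff_lt_succ.2 fun j => (p.step j).2,
      (σ.apply_symm_apply _).trans hx, fun j => by simpa using (p.step j).1⟩

theorem bddAbove_relSeries_orientation (G : SimpleGraph (Fin n)) (σ : Equiv.Perm (Fin n))
    (x : Fin n) :
    BddAbove {L | ∃ p : RelSeries (orientation G σ), L = p.length + 1 ∧ p.last = x} := by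
  refine ⟨n, ?_⟩
  rintro _ ⟨p, rfl, -⟩
  have hp : StrictMono (σ.symm ∘ p) := Fin.strictMono_iff_lt_succ.2 fun j => (p.step j).2
  simpa using Fintype.card_le_of_injective _ hp.injective

theorem length_succ_le_rank_last (p : RelSeries (orientation G σ)) :
    p.length + 1 ≤ rank G σ p.last := by
  rw [rank_eq_sSup_relSeries]
  exact le_csSup (bddAbove_relSeries_orientation G σ p.last) ⟨p, rfl, rfl⟩

theorem exists_relSeries_length_succ_eq_rank (G : SimpleGraph (Fin n))
    (σ : Equiv.Perm (Fin n)) (x : Fin n) :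
    ∃ p : RelSeries (orientation G σ), rank G σ x = p.length + 1 ∧ p.last = x := by
  rw [rank_eq_sSup_relSeries]
  refine Nat.sSup_mem ?_ (bddAbove_relSeries_orientation G σ x)
  exact ⟨1, RelSeries.singleton _ x, rfl, rfl⟩

theorem rank_lt_rank_of_mem_orientation {x y : Fin n} (hxy : (x, y) ∈ orientation G σ) :
    rank G σ x < rank G σ y := by
  obtain ⟨p, hp, rfl⟩ := exists_relSeries_length_succ_eq_rank G σ x
  have hsnoc := length_succ_le_rank_last (p.snoc y hxy)
  rw [p.last_snoc y hxy] at hsnoc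
  exact hp.trans_lt hsnoc

theorem orientation_eq_of_antitone_comp (hκ : ∀ u v, G.Adj u v → κ u ≠ κ v)
    (hσ : Antitone (κ ∘ σ)) : orientation G σ = {e | G.Adj e.1 e.2 ∧ κ e.2 < κ e.1} :=
  Set.ext fun _ => and_congr_right fun hadj =>
    lt_symm_iff_of_antitone_comp hσ fun he => absurd he (hκ _ _ hadj)

theorem rank_eq_rank_of_antitone_comp (hκ : ∀ u v, G.Adj u v → κ u ≠ κ v)
    (hσ : Antitone (κ ∘ σ)) (hτ : Antitone (κ ∘ τ)) : rank G σ = rank G τ := by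
  funext x
  rw [rank_eq_sSup_relSeries, rank_eq_sSup_relSeries, orientation_eq_of_antitone_comp hκ hσ,
    orientation_eq_of_antitone_comp hκ hτ]

theorem ne_of_isFWord_compl_DES (h : IsFWord n (DES G σ)ᶜ (κ ∘ σ)) {u v : Fin n}
    (huv : G.Adj u v) : κ u ≠ κ v := by
  wlog hlt : σ.symm u < σ.symm v generalizing u v
  · have hne : σ.symm v ≠ σ.symm u := σ.symm.injective.ne huv.ne'
    exact (this huv.symm (hne.lt_of_le (not_lt.1 hlt))).symm
  have hrank : rank G σ u < rank G σ v := rank_lt_rank_of_mem_orientation ⟨huv, hlt⟩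
  have hkey : sortKey κ (rank G σ) v < sortKey κ (rank G σ) u := by
    simpa using isFWord_compl_DES_iff.1 h hlt
  intro hcolor
  have htie := (Prod.Lex.toLex_lt_toLex'.1 hkey).2 hcolor.symm
  exact hrank.not_ge (Prod.Lex.toLex_lt_toLex'.1 htie).1

theorem existsUnique_isFWord_compl_DES (hκ : ∀ u v, G.Adj u v → κ u ≠ κ v) :
    ∃! σ : Equiv.Perm (Fin n), IsFWord n (DES G σ)ᶜ (κ ∘ σ) := by
  obtain ⟨ρ, hρ⟩ := exists_antitone_comp_perm κ
  have hiff : ∀ σ : Equiv.Perm (Fin n),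
      IsFWord n (DES G σ)ᶜ (κ ∘ σ) ↔ StrictAnti (sortKey κ (rank G ρ) ∘ σ) := by
    intro σ
    constructor
    · intro h
      rw [rank_eq_rank_of_antitone_comp hκ hρ h.1]
      exact isFWord_compl_DES_iff.1 h
    · intro h
      have hσ : Antitone (κ ∘ σ) := Prod.Lex.monotone_fst_ofLex.comp_antitone h.antitone
      rw [isFWord_compl_DES_iff, rank_eq_rank_of_antitone_comp hκ hσ hρ]
      exact h
  simp only [hiff]
  exact existsUnique_strictAnti_comp_perm (sortKey_injective κ (rank G ρ))

variable {D : Digraph (Fin n)}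

theorem asc_eq_inv_of_antitone_comp (hκ : IsProper D κ) (hσ : Antitone (κ ∘ σ)) :
    asc D κ = inv D σ := by
  classical
  refine congrArg Finset.card (Finset.filter_congr fun e _ => and_congr_right fun hadj => ?_)
  refine (lt_symm_iff_of_antitone_comp hσ fun hcolor => ?_).symm
  by_contra hne
  exact hκ _ _ ((SimpleGraph.fromRel_adj _ _ _).2 ⟨hne, Or.inr hadj⟩) hcolor

open Classical in
theorem ite_isProper_pow_asc_eq_sum {R : Type*} [Semiring R] (t : R) (D : Digraph (Fin n))
    (κ : Fin n → ℕ+) :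
    (if IsProper D κ then t ^ asc D κ else 0) = ∑ σ : Equiv.Perm (Fin n),
      if IsFWord n (DES D.toSimpleGraphInclusive σ)ᶜ (κ ∘ σ) then t ^ inv D σ else 0 := by
  split_ifs with hκ
  · obtain ⟨σ, hσ, huniq⟩ := existsUnique_isFWord_compl_DES hκ
    rw [Finset.sum_eq_single_of_mem σ (Finset.mem_univ σ) fun τ _ hne =>
      if_neg fun hτ => hne (huniq τ hτ), if_pos hσ, asc_eq_inv_of_antitone_comp hκ hσ.1]
  · exact (Finset.sum_eq_zero fun σ _ => if_neg fun hσ =>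
      hκ fun _ _ => ne_of_isFWord_compl_DES hσ).symm

end Words

section GeneratingSeries

variable {R : Type*} [CommRing R] {V W : Type*} [Fintype V] [Fintype W]

theorem genSeries_sum_smul {ι : Type*} (s : Finset ι) (c : ι → R) (wt : ι → (V → ℕ+) → R) :
    genSeries (fun κ => ∑ i ∈ s, c i * wt i κ) = ∑ i ∈ s, c i • genSeries (wt i) := by
  ext m
  simp only [map_sum, map_smul, coeff_genSeries, smul_eq_mul, Finset.mul_sum]
  exact Finset.sum_comm

theorem genSeries_comp_equiv (wt : (W → ℕ+) → R) (e : W ≃ V) :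
    genSeries (fun κ : V → ℕ+ => wt (κ ∘ e)) = genSeries wt := by
  have hxMon : ∀ κ : V → ℕ+, xMon (κ ∘ e) = xMon κ := fun κ =>
    Equiv.sum_comp e fun v => Finsupp.single (κ v) 1
  ext m
  rw [coeff_genSeries, coeff_genSeries]
  refine Finset.sum_equiv (e.symm.arrowCongr (Equiv.refl ℕ+)) (fun κ => ?_) fun κ _ => rfl
  rw [mem_withMon, mem_withMon, ← hxMon κ]
  rfl

end GeneratingSeries

theorem chromatic_eq_sum_fundamental {n : ℕ} (D : Digraph (Fin n)) :
    chromatic D = ∑ σ : Equiv.Perm (Fin n), ((Polynomial.X : Polynomial ℚ) ^ inv D σ) •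
      fundamental (Polynomial ℚ) n (DES D.toSimpleGraphInclusive σ)ᶜ := by
  classical
  refine Subtype.ext ?_
  calc (chromatic D : MvPowerSeries ℕ+ (Polynomial ℚ))
    _ = genSeries fun κ => ∑ σ : Equiv.Perm (Fin n), Polynomial.X ^ inv D σ *
          if IsFWord n (DES D.toSimpleGraphInclusive σ)ᶜ (κ ∘ σ) then 1 else 0 := by
      simp only [chromatic, ite_isProper_pow_asc_eq_sum, mul_ite, mul_one, mul_zero]
    _ = ∑ σ : Equiv.Perm (Fin n), (Polynomial.X : Polynomial ℚ) ^ inv D σ •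
          genSeries fun w => if IsFWord n (DES D.toSimpleGraphInclusive σ)ᶜ w then 1 else 0 := by
      rw [genSeries_sum_smul]
      exact Finset.sum_congr rfl fun σ _ => congrArg _ (genSeries_comp_equiv
        (fun w => if IsFWord n (DES D.toSimpleGraphInclusive σ)ᶜ w then 1 else 0) σ)
    _ = _ := by
      simp only [Submodule.coe_sum, Submodule.coe_smul, fundamental]

theorem IsFPositive.sum {ι : Type*} {s : Finset ι} {f : ι → QSym (Polynomial ℚ)}
    (hf : ∀ i ∈ s, IsFPositive (f i)) : IsFPositive (∑ i ∈ s, f i) := by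
  intro p k
  rw [map_sum, Finsupp.finsetSum_apply, Polynomial.finsetSum_coeff]
  exact Finset.sum_nonneg fun i hi => hf i hi p k

theorem isFPositive_X_pow_smul_fundamental (a n : ℕ) (S : Finset (Fin (n - 1))) :
    IsFPositive ((Polynomial.X : Polynomial ℚ) ^ a • fundamental (Polynomial ℚ) n S) := by
  classical
  intro p k
  rw [← fundamentalBasis_apply, map_smul, Module.Basis.repr_self, Finsupp.smul_single,
    smul_eq_mul, mul_one, Finsupp.single_apply]
  split_ifs
  · rw [Polynomial.coeff_X_pow]
    positivity
  · rw [Polynomial.coeff_zero]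

end ChromaticQSym

theorem theorem3p1 (n : ℕ) (D : Digraph (Fin n)) (hD : ∀ v, ¬ D.Adj v v) :
    ChromaticQSym.omega (Polynomial ℚ) (ChromaticQSym.chromatic D) =
        ∑ σ : Equiv.Perm (Fin n), ((Polynomial.X : Polynomial ℚ) ^ ChromaticQSym.inv D σ) •
          ChromaticQSym.fundamental (Polynomial ℚ) n
            (ChromaticQSym.DES D.toSimpleGraphInclusive σ) ∧
      ChromaticQSym.IsFPositive
        (ChromaticQSym.omega (Polynomial ℚ) (ChromaticQSym.chromatic D)) := by
  have hexpand : ChromaticQSym.omega (Polynomial ℚ) (ChromaticQSym.chromatic D) =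
      ∑ σ : Equiv.Perm (Fin n), ((Polynomial.X : Polynomial ℚ) ^ ChromaticQSym.inv D σ) •
        ChromaticQSym.fundamental (Polynomial ℚ) n
          (ChromaticQSym.DES D.toSimpleGraphInclusive σ) := by
    simp only [ChromaticQSym.chromatic_eq_sum_fundamental, map_sum, map_smul,
      ChromaticQSym.omega_fundamental, compl_compl]
  refine ⟨hexpand, ?_⟩
  rw [hexpand]
  exact .sum fun σ _ => ChromaticQSym.isFPositive_X_pow_smul_fundamental _ _ _
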